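/- **Theorem.** Let $E$ be a real Banach lattice that is $\sigma$-Dedekind complete, i.e. every nonempty countable subset of $E$ that is bounded above has a supremum. Let $E^*$ be its norm dual with the order $f\le g \iff f(x)\le g(x)$ for all $x\ge 0$, which makes it a lattice. A sequence $(u_n)$ in $E$ or in $E^*$ is called *disjoint* if $|u_m|\wedge|u_n|=0$ whenever $m\ne n$, and a sequence $(f_n)$ in $E^*$ is called *$w^*$-null* if $f_n(x)\to 0$ for every $x\in E$. A norm bounded set $A\subseteq E$ is called *almost limited* if $\sup_{x\in A}|f_n(x)|\to 0$ for every disjoint $w^*$-null sequence $(f_n)$ in $E^*$. Let $S\subseteq E$ be norm bounded and solid, i.e. $x\in S$, $y\in E$ and $|y|\le|x|$ imply $y\in S$. Then the following statements are equivalent: 1. $S$ is almost limited. 2. For each disjoint sequence $(x_n)$ in $S$ and each disjoint $w^*$-null sequence $(f_n)$ in $E^*$, $\lim_n f_n(x_n)=0$. 3. For each disjoint sequence $(x_n)$ in $S$ with $x_n\ge 0$ for all $n$, and each disjoint $w^*$-null sequence $(f_n)$ in $E^*$ with $f_n\ge 0$ for all $n$, $\lim_n f_n(x_n)=0$. -/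

import Mathlib

open Set Filter Topology

noncomputable section

set_option linter.unusedSectionVars false

namespace BanachLattice

section Dual

variable {E : Type*} [NormedAddCommGroup E] [NormedSpace ℝ E] [Lattice E]

/-- The value at `x ≥ 0` of the positive part of `f`: the supremum of `f` over `[0, x]`. -/
def posPartAux (f : StrongDual ℝ E) (x : E) : ℝ := sSup (f '' Icc 0 x)

variable [IsOrderedAddMonoid E] [HasSolidNorm E]

theorem norm_le_of_mem_Icc {x y : E} (hy : y ∈ Icc 0 x) : ‖y‖ ≤ ‖x‖ :=
  norm_le_norm_of_abs_le_abs (by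
    rw [abs_of_nonneg hy.1, abs_of_nonneg (hy.1.trans hy.2)]; exact hy.2)

theorem le_bound (f : StrongDual ℝ E) {x y : E} (hy : y ∈ Icc 0 x) : f y ≤ ‖f‖ * ‖x‖ :=
  (le_abs_self _).trans ((f.le_opNorm y).trans
    (mul_le_mul_of_nonneg_left (norm_le_of_mem_Icc hy) (norm_nonneg f)))

theorem le_posPartAux (f : StrongDual ℝ E) {x y : E} (hy : y ∈ Icc 0 x) :
    f y ≤ posPartAux f x :=
  le_csSup ⟨‖f‖ * ‖x‖, by rintro _ ⟨z, hz, rfl⟩; exact le_bound f hz⟩ ⟨y, hy, rfl⟩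

theorem posPartAux_le (f : StrongDual ℝ E) {x : E} (hx : 0 ≤ x) {c : ℝ}
    (h : ∀ y ∈ Icc 0 x, f y ≤ c) : posPartAux f x ≤ c :=
  csSup_le ⟨_, 0, ⟨le_rfl, hx⟩, rfl⟩ (by rintro _ ⟨z, hz, rfl⟩; exact h z hz)

theorem posPartAux_nonneg (f : StrongDual ℝ E) {x : E} (hx : 0 ≤ x) : 0 ≤ posPartAux f x := by
  simpa using le_posPartAux f (x := x) (y := 0) ⟨le_rfl, hx⟩

theorem posPartAux_add (f : StrongDual ℝ E) {x y : E} (hx : 0 ≤ x) (hy : 0 ≤ y) :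
    posPartAux f (x + y) = posPartAux f x + posPartAux f y := by
  apply le_antisymm
  · refine posPartAux_le f (add_nonneg hx hy) fun z hz => ?_
    have h1 : f (z ⊓ x) ≤ posPartAux f x := le_posPartAux f ⟨le_inf hz.1 hx, inf_le_right⟩
    have h2 : f (z - z ⊓ x) ≤ posPartAux f y := by
      refine le_posPartAux f ⟨sub_nonneg.2 inf_le_left, ?_⟩
      rw [sub_le_iff_le_add, ← sub_le_iff_le_add']
      exact le_inf (by simpa using hy) (by simpa using hz.2)
    rw [map_sub] at h2
    linarith
  · rw [← le_sub_iff_add_le]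
    refine posPartAux_le f hx fun a ha => ?_
    rw [le_sub_comm]
    refine posPartAux_le f hy fun b hb => ?_
    have := le_posPartAux f (x := x + y) (y := a + b)
      ⟨add_nonneg ha.1 hb.1, add_le_add ha.2 hb.2⟩
    rw [map_add] at this
    linarith

theorem posPartAux_sub_eq (f : StrongDual ℝ E) {a b c d : E} (ha : 0 ≤ a) (hb : 0 ≤ b)
    (hc : 0 ≤ c) (hd : 0 ≤ d) (h : a - b = c - d) :
    posPartAux f a - posPartAux f b = posPartAux f c - posPartAux f d := by
  have h' : a + d = c + b := by rw [sub_eq_sub_iff_add_eq_add] at h; exact h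
  have := congrArg (posPartAux f) h'
  rw [posPartAux_add f ha hd, posPartAux_add f hc hb] at this
  linarith

/-- The additive extension of `posPartAux f` from the positive cone to the whole space. -/
def posPartAddHom (f : StrongDual ℝ E) : E →+ ℝ :=
  AddMonoidHom.mk' (fun x => posPartAux f x⁺ - posPartAux f x⁻) fun x y => by
    have h := posPartAux_sub_eq f (posPart_nonneg (x + y)) (negPart_nonneg (x + y))
      (add_nonneg (posPart_nonneg x) (posPart_nonneg y))
      (add_nonneg (negPart_nonneg x) (negPart_nonneg y)) (by
        rw [posPart_sub_negPart, add_sub_add_comm, posPart_sub_negPart, posPart_sub_negPart])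
    rw [posPartAux_add f (posPart_nonneg x) (posPart_nonneg y),
      posPartAux_add f (negPart_nonneg x) (negPart_nonneg y)] at h
    linarith

theorem posPartAddHom_of_nonneg (f : StrongDual ℝ E) {x : E} (hx : 0 ≤ x) :
    posPartAddHom f x = posPartAux f x := by
  have h := posPartAux_sub_eq f (posPart_nonneg x) (negPart_nonneg x) hx le_rfl (by
    rw [posPart_sub_negPart, sub_zero])
  have h0 : posPartAux f (0 : E) = 0 := by
    have := posPartAux_add f (le_refl (0 : E)) le_rfl
    rw [add_zero] at this
    linarith
  rw [h0, sub_zero] at h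
  exact h

theorem posPartAddHom_bound (f : StrongDual ℝ E) (x : E) : ‖posPartAddHom f x‖ ≤ ‖f‖ * ‖x‖ := by
  have key : ∀ z : E, 0 ≤ z → z ≤ |x| → 0 ≤ posPartAux f z ∧ posPartAux f z ≤ ‖f‖ * ‖x‖ := by
    intro z hz hzx
    refine ⟨posPartAux_nonneg f hz, posPartAux_le f hz fun y hy => ?_⟩
    rw [← norm_abs_eq_norm x]
    exact le_bound f ⟨hy.1, hy.2.trans hzx⟩
  have h1 := key _ (posPart_nonneg x) (by
    rw [← posPart_add_negPart]; exact le_add_of_nonneg_right (negPart_nonneg x))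
  have h2 := key _ (negPart_nonneg x) (by
    rw [← posPart_add_negPart]; exact le_add_of_nonneg_left (posPart_nonneg x))
  change |posPartAux f x⁺ - posPartAux f x⁻| ≤ _
  rw [abs_le]
  constructor <;> linarith

/-- The positive part of a bounded functional, given on the positive cone by the
Riesz-Kantorovich formula `x ↦ sup {f y | 0 ≤ y ≤ x}`. -/
def dualPosPart (f : StrongDual ℝ E) : StrongDual ℝ E :=
  (posPartAddHom f).toRealLinearMap
    (AddMonoidHomClass.continuous_of_bound (posPartAddHom f) ‖f‖ (posPartAddHom_bound f))

theorem dualPosPart_of_nonneg (f : StrongDual ℝ E) {x : E} (hx : 0 ≤ x) :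
    dualPosPart f x = sSup (f '' Icc 0 x) :=
  posPartAddHom_of_nonneg f hx

/-- The order of the dual: `f ≤ g` if and only if `f x ≤ g x` for every `x ≥ 0`. -/
instance dualPartialOrder : PartialOrder (StrongDual ℝ E) where
  le f g := ∀ x : E, 0 ≤ x → f x ≤ g x
  le_refl _ _ _ := le_rfl
  le_trans _ _ _ h h' x hx := (h x hx).trans (h' x hx)
  le_antisymm f g h h' := by
    ext x
    rw [← posPart_sub_negPart x, map_sub, map_sub,
      le_antisymm (h _ (posPart_nonneg x)) (h' _ (posPart_nonneg x)),
      le_antisymm (h _ (negPart_nonneg x)) (h' _ (negPart_nonneg x))]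

theorem dual_le_iff {f g : StrongDual ℝ E} : f ≤ g ↔ ∀ x : E, 0 ≤ x → f x ≤ g x := Iff.rfl

theorem le_dualPosPart (f : StrongDual ℝ E) : f ≤ dualPosPart f := fun x hx => by
  rw [dualPosPart_of_nonneg f hx]
  exact le_posPartAux f ⟨hx, le_rfl⟩

theorem dualPosPart_nonneg (f : StrongDual ℝ E) {x : E} (hx : 0 ≤ x) : 0 ≤ dualPosPart f x := by
  rw [dualPosPart_of_nonneg f hx]
  exact posPartAux_nonneg f hx

theorem dualPosPart_le {f h : StrongDual ℝ E} (hf : f ≤ h) (h0 : ∀ x : E, 0 ≤ x → 0 ≤ h x) :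
    dualPosPart f ≤ h := fun x hx => by
  rw [dualPosPart_of_nonneg f hx]
  refine posPartAux_le f hx fun y hy => (hf y hy.1).trans ?_
  have := h0 (x - y) (sub_nonneg.2 hy.2)
  rw [map_sub] at this
  linarith

/-- The norm dual of a normed lattice is a lattice; this is the lattice structure of the order
`dualPartialOrder`. -/
instance dualLattice : Lattice (StrongDual ℝ E) where
  __ := dualPartialOrder
  sup f g := g + dualPosPart (f - g)
  inf f g := f - dualPosPart (f - g)
  le_sup_left f g x hx := by
    have := le_dualPosPart (f - g) x hx
    simp only [add_apply, sub_apply] at *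
    linarith
  le_sup_right f g x hx := by
    have := dualPosPart_nonneg (f - g) hx
    simp only [add_apply] at *
    linarith
  sup_le f g h hf hg x hx := by
    have := dualPosPart_le (f := f - g) (h := h - g)
      (fun y hy => sub_le_sub_right (hf y hy) (g y)) (fun y hy => sub_nonneg.2 (hg y hy)) x hx
    simp only [add_apply, sub_apply] at *
    linarith
  inf_le_left f g x hx := by
    have := dualPosPart_nonneg (f - g) hx
    simp only [sub_apply] at *
    linarith
  inf_le_right f g x hx := by
    have := le_dualPosPart (f - g) x hx
    simp only [sub_apply] at *
    linarith
  le_inf h f g hf hg x hx := by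
    have := dualPosPart_le (f := f - g) (h := f - h)
      (fun y hy => sub_le_sub_left (hg y hy) (f y)) (fun y hy => sub_nonneg.2 (hf y hy)) x hx
    simp only [sub_apply] at *
    linarith

end Dual

/-- A sequence in a vector lattice is disjoint if its terms are pairwise disjoint:
`|u m| ⊓ |u n| = 0` for `m ≠ n`. -/
def IsDisjointSeq {V : Type*} [Lattice V] [AddCommGroup V] (u : ℕ → V) : Prop :=
  Pairwise fun m n => |u m| ⊓ |u n| = 0

/-- Every nonempty countable subset that is bounded above has a supremum. -/
def IsSigmaDedekindComplete (E : Type*) [Preorder E] : Prop :=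
  ∀ A : Set E, A.Nonempty → A.Countable → BddAbove A → ∃ s, IsLUB A s

/-- The sequence of functionals converges to zero in the weak-star topology. -/
def IsWeakStarNull {E : Type*} [NormedAddCommGroup E] [NormedSpace ℝ E]
    (f : ℕ → StrongDual ℝ E) : Prop :=
  Tendsto (fun n => StrongDual.toWeakDual (f n)) atTop (𝓝 0)

/-- A norm bounded set on which every disjoint weak-star null sequence of functionals converges
uniformly to zero. -/
def IsAlmostLimited {E : Type*} [NormedAddCommGroup E] [NormedSpace ℝ E] [Lattice E]
    [IsOrderedAddMonoid E] [HasSolidNorm E] (A : Set E) : Prop :=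
  Bornology.IsBounded A ∧ ∀ f : ℕ → StrongDual ℝ E, IsDisjointSeq f → IsWeakStarNull f →
    TendstoUniformlyOn (fun n x => f n x) (fun _ => 0) atTop A

end BanachLattice

end

open Set Filter Topology

section

set_option linter.unusedSectionVars false

namespace BanachLattice

/-! Only the passage from 3 to 1 has content. It rests on two facts.

The moduli of a disjoint weak-star null sequence are weak-star null (`IsWeakStarNull.abs`).
Rosenthal's lemma together with order sums over arbitrary index sets gives a Phillips lemma: the
functionals cannot stay away from zero along an order bounded series of positive terms. Hence their
moduli are uniformly Cauchy along order bounded increasing sequences. If `|f n| x ≥ ε` for all `n`,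
disjointness gives `y n` in `[0, x]` carrying almost all of `|f n| x` and nearly invisible to the
earlier functionals. Heuristically every `|f m|` kills `w = limsup y n`, while `x - w` is
approximated, uniformly for all functionals, by elements nearly below `x - y m` for large `m`, where
`|f m|` is small: a contradiction. Functionals need not be order continuous, so the proof uses
finite stages of these suprema.

Positive weak-star null functionals that are not small on a bounded positive sequence are not small
on some disjoint sequence below it (`exists_isDisjointSeq_le`). If `S` is not almost limited, this
applied to `|f n|` and `|x n|` gives a disjoint sequence, in `S` by solidity, that violates 3. -/

/-! ### Rosenthal's lemma and order sums. -/

/-- Rosenthal's lemma for a uniformly bounded sequence of superadditive set functions on `ℕ`. -/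
theorem exists_infinite_offDiag_lt {m : ℕ → Set ℕ → ℝ}
    (hm : ∀ k A B C, Disjoint A B → A ∪ B ⊆ C → m k A + m k B ≤ m k C)
    {M : ℝ} (hM : ∀ k A, m k A ≤ M) {ε : ℝ} (hε : 0 < ε) :
    ∃ J : Set ℕ, J.Infinite ∧ ∀ k ∈ J, m k (J \ {k}) < ε := by
  have key : ∀ N : ℕ, ∀ I : Set ℕ, I.Infinite → (∀ k ∈ I, m k (I \ {k}) ≤ N * ε) →
      ∃ J : Set ℕ, J.Infinite ∧ ∀ k ∈ J, m k (J \ {k}) < ε := by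
    intro N
    induction N with
    | zero =>
      intro I hI h
      exact ⟨I, hI, fun k hk => (h k hk).trans_lt (by simpa using hε)⟩
    | succ N ih =>
      intro I hI h
      set e : ℕ ↪ I := hI.natEmbedding
      -- The pairing function yields infinitely many disjoint infinite pieces of `I`.
      set P : ℕ → Set ℕ := fun p => range fun q => (e (Nat.pair p q) : ℕ) with hP
      have hPI : ∀ p, P p ⊆ I := by
        rintro p _ ⟨q, rfl⟩
        exact (e _).2
      have hPdisj : ∀ p q k, k ∈ P p → k ∈ P q → p = q := by
        rintro p q _ ⟨a, rfl⟩ ⟨b, hb⟩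
        have := e.injective (Subtype.ext hb)
        exact ((Nat.pair_eq_pair.1 this).1).symm
      by_cases hgood : ∃ p, ∀ k ∈ P p, m k (P p \ {k}) < ε
      · obtain ⟨p, hp⟩ := hgood
        refine ⟨P p, infinite_range_of_injective fun a b hab => ?_, hp⟩
        exact (Nat.pair_eq_pair.1 (e.injective (Subtype.ext hab))).2
      -- One bad index from each piece: `range k \ {k p}` misses `P p`, whose part off `k p` already
      -- has mass at least `ε`, so superadditivity lowers the bound by `ε`.
      · push Not at hgood
        choose k hk hkε using hgood
        have hkinj : Function.Injective k := fun p q hpq =>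
          hPdisj p q (k p) (hk p) (hpq ▸ hk q)
        refine ih (range k) (infinite_range_of_injective hkinj) ?_
        rintro _ ⟨p, rfl⟩
        have h1 := hm (k p) (range k \ {k p}) (P p \ {k p}) (I \ {k p}) (by
          rw [Set.disjoint_left]
          rintro _ ⟨⟨q, rfl⟩, hq⟩ ⟨hq', -⟩
          exact hq (congrArg k (hPdisj q p _ (hk q) hq'))) (by
          rintro a (⟨⟨q, rfl⟩, ha⟩ | ⟨h', ha⟩)
          · exact ⟨hPI q (hk q), ha⟩
          · exact ⟨hPI p h', ha⟩)
        have h2 := h (k p) (hPI p (hk p))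
        have h3 := hkε p
        push_cast at h2
        linarith
  obtain ⟨N, hN⟩ := exists_nat_ge (M / ε)
  exact key N univ infinite_univ fun k _ => (hM _ _).trans ((div_le_iff₀ hε).1 hN)

/-- In a `σ`-Dedekind complete ordered group, a sequence of nonnegative terms with bounded partial
sums can be summed in order over every set of indices. -/
theorem exists_orderSum {E : Type*} [AddCommGroup E] [Lattice E] [IsOrderedAddMonoid E]
    (hE : IsSigmaDedekindComplete E) {d : ℕ → E} (hd : ∀ k, 0 ≤ d k) {x : E}
    (hx : ∀ n, ∑ k ∈ Finset.range n, d k ≤ x) :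
    ∃ T : Set ℕ → E, (∀ A, 0 ≤ T A ∧ T A ≤ x) ∧ (∀ k, T {k} = d k) ∧
      ∀ A B, Disjoint A B → T (A ∪ B) = T A + T B := by
  set s : Set ℕ → ℕ → E := fun A n => ∑ k ∈ Finset.range n, A.indicator d k with hs
  have hind : ∀ (A : Set ℕ) k, 0 ≤ A.indicator d k := fun A k => Set.indicator_nonneg (fun i _ => hd i) k
  have hmono : ∀ A, Monotone (s A) := fun A => monotone_nat_of_le_succ fun n => by
    simp only [hs, Finset.sum_range_succ]
    exact le_add_of_nonneg_right (hind A n)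
  have hsx : ∀ A n, s A n ≤ x := fun A n =>
    (Finset.sum_le_sum fun k _ => Set.indicator_le_self' (fun i _ => hd i) k).trans (hx n)
  have hT : ∀ A, ∃ t, IsLUB (range (s A)) t := fun A =>
    hE _ (range_nonempty _) (countable_range _) ⟨x, by rintro _ ⟨n, rfl⟩; exact hsx A n⟩
  choose T hT using hT
  have hle : ∀ A n, s A n ≤ T A := fun A n => (hT A).1 ⟨n, rfl⟩
  have hleast : ∀ A c, (∀ n, s A n ≤ c) → T A ≤ c := fun A c h =>
    (hT A).2 (by rintro _ ⟨n, rfl⟩; exact h n)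
  refine ⟨T, fun A => ⟨by simpa [hs] using hle A 0, hleast A x (hsx A)⟩, fun k => ?_, ?_⟩
  · apply le_antisymm
    · refine hleast _ _ fun n => ?_
      simp only [hs]
      by_cases hk : k ∈ Finset.range n
      · rw [Finset.sum_eq_single_of_mem k hk fun j _ hj => by simp [hj]]
        simp
      · rw [Finset.sum_eq_zero fun j hj => by
          have : j ≠ k := fun h => hk (h ▸ hj)
          simp [this]]
        exact hd k
    · have := hle {k} (k + 1)
      simp only [hs] at this
      rw [Finset.sum_eq_single_of_mem k (by simp) fun j _ hj => by simp [hj]] at this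
      simpa using this
  · intro A B hAB
    have hadd : ∀ n, s (A ∪ B) n = s A n + s B n := fun n => by
      simp only [hs, ← Finset.sum_add_distrib]
      refine Finset.sum_congr rfl fun k _ => ?_
      rw [Set.indicator_union_of_disjoint hAB]
    apply le_antisymm
    · refine hleast _ _ fun n => ?_
      rw [hadd]
      exact add_le_add (hle A n) (hle B n)
    · rw [← le_sub_iff_add_le]
      refine hleast _ _ fun i => ?_
      rw [le_sub_comm]
      refine hleast _ _ fun j => ?_
      rw [le_sub_iff_add_le']
      calc s A i + s B j ≤ s A (max i j) + s B (max i j) :=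
            add_le_add (hmono A (le_max_left _ _)) (hmono B (le_max_right _ _))
        _ = s (A ∪ B) (max i j) := (hadd _).symm
        _ ≤ _ := hle _ _

/-! ### Moduli and disjointness in the dual. -/

section Dual

variable {E : Type*} [NormedAddCommGroup E] [NormedSpace ℝ E] [Lattice E]
  [IsOrderedAddMonoid E] [HasSolidNorm E]

theorem isWeakStarNull_iff {f : ℕ → StrongDual ℝ E} :
    IsWeakStarNull f ↔ ∀ y, Tendsto (fun n => f n y) atTop (𝓝 0) := by
  unfold IsWeakStarNull
  rw [tendsto_iff_forall_eval_tendsto_topDualPairing]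
  rfl

theorem dual_apply_mono {g : StrongDual ℝ E} (hg : 0 ≤ g) {a b : E} (h : a ≤ b) : g a ≤ g b := by
  have : 0 ≤ g (b - a) := hg _ (sub_nonneg.2 h)
  rw [map_sub] at this
  linarith

theorem dual_apply_nonneg {g : StrongDual ℝ E} (hg : 0 ≤ g) {a : E} (h : 0 ≤ a) : 0 ≤ g a :=
  hg a h

theorem abs_dual_apply_le {f : StrongDual ℝ E} {x : E} (hx : 0 ≤ x) : |f x| ≤ |f| x := by
  have h1 : f x ≤ |f| x := le_abs_self f x hx
  have h2 : (-f) x ≤ |f| x := neg_le_abs f x hx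
  rw [neg_apply] at h2
  exact abs_le.2 ⟨by linarith, h1⟩

theorem dual_abs_nonneg (f : StrongDual ℝ E) : 0 ≤ |f| := fun _ hx =>
  (abs_nonneg _).trans (abs_dual_apply_le hx)

theorem dual_abs_of_nonneg {f : StrongDual ℝ E} (hf : 0 ≤ f) : |f| = f := by
  refine le_antisymm (sup_le le_rfl fun x hx => ?_) (le_abs_self f)
  have : 0 ≤ f x := hf x hx
  rw [neg_apply]
  linarith

theorem abs_dual_apply_le_abs (f : StrongDual ℝ E) (x : E) : |f x| ≤ |f| |x| := by
  have h1 := abs_dual_apply_le (f := f) (posPart_nonneg x)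
  have h2 := abs_dual_apply_le (f := f) (negPart_nonneg x)
  rw [← posPart_add_negPart x, map_add]
  conv_lhs => rw [← posPart_sub_negPart x, map_sub]
  exact (abs_sub _ _).trans (add_le_add h1 h2)

/-- Since `|f| = -f + (2f)⁺`, the Riesz-Kantorovich formula gives `c + 2c`. Only the finiteness of
the constant matters. -/
theorem dual_abs_apply_le {f : StrongDual ℝ E} {x : E} (hx : 0 ≤ x) {c : ℝ}
    (h : ∀ y ∈ Icc 0 x, |f y| ≤ c) : |f| x ≤ 3 * c := by
  have h1 : |f| x = -f x + dualPosPart (f - -f) x := rfl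
  have h2 : dualPosPart (f - -f) x ≤ 2 * c := by
    rw [dualPosPart_of_nonneg _ hx]
    refine posPartAux_le _ hx fun y hy => ?_
    have := le_of_abs_le (h y hy)
    simp only [sub_apply, neg_apply]
    linarith
  have h3 := neg_le_of_abs_le (h x ⟨hx, le_rfl⟩)
  rw [h1]
  linarith

/-- Disjoint positive functionals are almost carried by complementary parts of any `x ≥ 0`. -/
theorem exists_mem_Icc_of_inf_eq_zero {g h : StrongDual ℝ E} (hgh : g ⊓ h = 0) {x : E} (hx : 0 ≤ x)
    {η : ℝ} (hη : 0 < η) : ∃ y ∈ Icc 0 x, g (x - y) + h y < η := by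
  by_contra! hcon
  -- The infimum in the dual is by definition `g - (g - h)⁺`.
  have h1 : g x - dualPosPart (g - h) x = 0 := by
    have := congrArg (fun φ : StrongDual ℝ E => φ x) hgh
    exact this
  have h2 : dualPosPart (g - h) x ≤ g x - η := by
    rw [dualPosPart_of_nonneg _ hx]
    refine posPartAux_le _ hx fun y hy => ?_
    have := hcon y hy
    rw [map_sub] at this
    rw [sub_apply]
    linarith
  linarith

/-- The infimum of the elements obtained for the single `h i` works: the defects `x - y` add up, so
`η` is halved at each insertion. -/
theorem exists_mem_Icc_forall_lt {g : StrongDual ℝ E} (hg : 0 ≤ g) {ι : Type*}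
    {h : ι → StrongDual ℝ E} (hh : ∀ i, 0 ≤ h i) (s : Finset ι) (hgh : ∀ i ∈ s, g ⊓ h i = 0)
    {x : E} (hx : 0 ≤ x) {η : ℝ} (hη : 0 < η) :
    ∃ y ∈ Icc 0 x, g (x - y) < η ∧ ∀ i ∈ s, h i y < η := by
  classical
  induction s using Finset.induction_on generalizing η with
  | empty => exact ⟨x, ⟨hx, le_rfl⟩, by simpa using hη, by simp⟩
  | insert i s _ ih =>
    obtain ⟨y, hy, hy1, hy2⟩ := ih (fun j hj => hgh j (Finset.mem_insert_of_mem hj)) (half_pos hη)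
    obtain ⟨z, hz, hz1⟩ :=
      exists_mem_Icc_of_inf_eq_zero (hgh i (Finset.mem_insert_self _ _)) hx (half_pos hη)
    have hgz := dual_apply_nonneg hg (sub_nonneg.2 hz.2)
    have hhz := dual_apply_nonneg (hh i) hz.1
    refine ⟨y ⊓ z, ⟨le_inf hy.1 hz.1, inf_le_left.trans hy.2⟩, ?_, fun j hj => ?_⟩
    · have hle : x - y ⊓ z ≤ (x - y) + (x - z) := by
        rw [sub_inf]
        exact sup_le (le_add_of_nonneg_right (sub_nonneg.2 hz.2))
          (le_add_of_nonneg_left (sub_nonneg.2 hy.2))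
      have := dual_apply_mono hg hle
      rw [map_add] at this
      linarith
    · rcases Finset.mem_insert.1 hj with rfl | hj
      · have := dual_apply_mono (hh j) (inf_le_right : y ⊓ z ≤ z)
        linarith
      · have := dual_apply_mono (hh j) (inf_le_left : y ⊓ z ≤ y)
        linarith [hy2 j hj]

/-! ### Phillips' lemma and uniform Cauchy estimates. -/

variable [CompleteSpace E]

theorem exists_dual_abs_apply_le {f : ℕ → StrongDual ℝ E}
    (hf : ∀ y, Tendsto (fun n => f n y) atTop (𝓝 0)) {x : E} (hx : 0 ≤ x) :
    ∃ M, ∀ n, |f n| x ≤ M := by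
  obtain ⟨C, hC⟩ := banach_steinhaus (g := f) fun y => by
    obtain ⟨C, hC⟩ := (hf y).norm.bddAbove_range
    exact ⟨C, fun i => hC ⟨i, rfl⟩⟩
  refine ⟨3 * (C * ‖x‖), fun n => dual_abs_apply_le hx fun y hy => ?_⟩
  exact ((f n).le_opNorm y).trans (mul_le_mul (hC n) (norm_le_of_mem_Icc hy) (norm_nonneg _)
    ((norm_nonneg _).trans (hC n)))

/-- A form of Phillips' lemma: a weak-star null sequence is not bounded away from zero along the
terms of an order bounded series. -/
theorem not_forall_le_abs_dual_apply (hE : IsSigmaDedekindComplete E) {f : ℕ → StrongDual ℝ E}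
    (hf : ∀ y, Tendsto (fun n => f n y) atTop (𝓝 0)) {d : ℕ → E} (hd : ∀ k, 0 ≤ d k) {x : E}
    (hx : ∀ n, ∑ k ∈ Finset.range n, d k ≤ x) {δ : ℝ} (hδ : 0 < δ) :
    ¬ ∀ k, δ ≤ |f k (d k)| := by
  intro hcon
  obtain ⟨T, hT, hTk, hTadd⟩ := exists_orderSum hE hd hx
  have hx0 : 0 ≤ x := by simpa using hx 0
  obtain ⟨M, hM⟩ := exists_dual_abs_apply_le hf hx0
  -- For `k ∈ J` the rest of the order sum over `J` contributes less than `δ / 2` to `f k (T J)`,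
  -- and `f k (T J)` tends to zero, so `f k (d k)` is too small.
  obtain ⟨J, hJ, hJδ⟩ := exists_infinite_offDiag_lt (m := fun k A => |f k| (T A)) (M := M)
    (fun k A B C hAB hC => by
      have : T C = T (A ∪ B) + T (C \ (A ∪ B)) := by
        rw [← hTadd _ _ disjoint_sdiff_right, Set.union_sdiff_cancel hC]
      rw [this, hTadd A B hAB, map_add, map_add]
      linarith [dual_apply_nonneg (dual_abs_nonneg (f k)) (hT (C \ (A ∪ B))).1])
    (fun k A => (dual_apply_mono (dual_abs_nonneg _) (hT A).2).trans (hM k)) (half_pos hδ)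
  have hev := (Metric.tendsto_nhds.1 (hf (T J))) (δ / 2) (half_pos hδ)
  obtain ⟨k, hkJ, hk⟩ := ((Nat.frequently_atTop_iff_infinite.2 hJ).and_eventually hev).exists
  have hTJ : T J = d k + T (J \ {k}) := by
    rw [← hTk, ← hTadd _ _ disjoint_sdiff_right, Set.union_sdiff_cancel (singleton_subset_iff.2 hkJ)]
  rw [Real.dist_eq, sub_zero, hTJ, map_add] at hk
  have h1 := (abs_dual_apply_le (f := f k) (hT (J \ {k})).1).trans_lt (hJδ k hkJ)
  have h2 := hcon k
  have h3 := abs_sub (f k (d k) + f k (T (J \ {k}))) (f k (T (J \ {k})))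
  rw [add_sub_cancel_right] at h3
  linarith

/-- For fixed `n` the series of `|f n| (d k)` converges, so the `n` attached to `k` must escape to
infinity; a subsequence reduces to the diagonal case. -/
theorem not_forall_exists_le_abs_dual_apply (hE : IsSigmaDedekindComplete E)
    {f : ℕ → StrongDual ℝ E} (hf : ∀ y, Tendsto (fun n => f n y) atTop (𝓝 0)) {d : ℕ → E}
    (hd : ∀ k, 0 ≤ d k) {x : E} (hx : ∀ n, ∑ k ∈ Finset.range n, d k ≤ x) {δ : ℝ} (hδ : 0 < δ) :
    ¬ ∀ k, ∃ n, δ ≤ |f n (d k)| := by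
  intro hcon
  have hsingle : ∀ n, Tendsto (fun k => |f n| (d k)) atTop (𝓝 0) := fun n => by
    refine (summable_of_sum_range_le (c := |f n| x)
      (fun k => dual_apply_nonneg (dual_abs_nonneg _) (hd k)) fun m => ?_).tendsto_atTop_zero
    rw [← map_sum]
    exact dual_apply_mono (dual_abs_nonneg _) (hx m)
  have hfreq : ∀ j, ∃ᶠ k in atTop, ∃ n, j ≤ n ∧ δ ≤ |f n (d k)| := fun j => by
    have hev : ∀ᶠ k in atTop, ∀ n ∈ Finset.range j, |f n| (d k) < δ :=
      (Finset.eventually_all _).2 fun n _ => (hsingle n).eventually_lt_const hδ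
    refine (hev.mono fun k hk => ?_).frequently
    obtain ⟨n, hn⟩ := hcon k
    refine ⟨n, ?_, hn⟩
    by_contra! hnj
    exact (hn.trans (abs_dual_apply_le (hd k))).not_gt (hk n (Finset.mem_range.2 hnj))
  obtain ⟨φ, hφ, hP⟩ := extraction_forall_of_frequently hfreq
  choose ν hν hνδ using hP
  refine not_forall_le_abs_dual_apply hE (f := fun j => f (ν j)) (d := fun j => d (φ j)) (x := x)
    (fun y => (hf y).comp (tendsto_atTop_mono hν tendsto_id)) (fun k => hd _) (fun n => ?_) hδ hνδ
  refine le_trans ?_ (hx (φ n))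
  rw [← Finset.sum_image (s := Finset.range n) (g := φ) (f := d) hφ.injective.injOn]
  refine Finset.sum_le_sum_of_subset_of_nonneg ?_ fun k _ _ => hd k
  intro k hk
  obtain ⟨i, hi, rfl⟩ := Finset.mem_image.1 hk
  exact Finset.mem_range.2 (hφ (Finset.mem_range.1 hi))

/-- The moduli of a weak-star null sequence are uniformly Cauchy along order bounded increasing
sequences. -/
theorem exists_forall_dual_abs_sub_lt (hE : IsSigmaDedekindComplete E)
    {f : ℕ → StrongDual ℝ E} (hf : ∀ y, Tendsto (fun n => f n y) atTop (𝓝 0)) {z : ℕ → E}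
    (hz : Monotone z) (hz0 : ∀ k, 0 ≤ z k) {x : E} (hx : ∀ k, z k ≤ x) {δ : ℝ} (hδ : 0 < δ) :
    ∃ K, ∀ k ≥ K, ∀ n, |f n| (z k - z K) < δ := by
  by_contra! hcon
  choose κ hκ ν hν using hcon
  set t : ℕ → ℕ := fun i => κ^[i] 0 with ht
  have ht1 : ∀ i, t (i + 1) = κ (t i) := fun i => Function.iterate_succ_apply' _ _ _
  have hd : ∀ i, 0 ≤ z (t (i + 1)) - z (t i) := fun i =>
    sub_nonneg.2 (hz (by rw [ht1]; exact hκ _))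
  -- With `δ / 4`, the factor 3 of `dual_abs_apply_le` still leaves less than `δ`.
  have hsel : ∀ i, ∃ y ∈ Icc 0 (z (t (i + 1)) - z (t i)), δ / 4 ≤ |f (ν (t i)) y| := fun i => by
    by_contra! h
    have h1 := dual_abs_apply_le (f := f (ν (t i))) (hd i) fun y hy => (h y hy).le
    have h2 := hν (t i)
    rw [← ht1] at h2
    linarith
  choose y hy hyδ using hsel
  refine not_forall_exists_le_abs_dual_apply hE hf (d := y) (fun k => (hy k).1) (x := x)
    (fun n => ?_) (δ := δ / 4) (by positivity) fun k => ⟨_, hyδ k⟩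
  calc ∑ k ∈ Finset.range n, y k ≤ ∑ k ∈ Finset.range n, (z (t (k + 1)) - z (t k)) :=
        Finset.sum_le_sum fun k _ => (hy k).2
    _ = z (t n) - z (t 0) := Finset.sum_range_sub (fun k => z (t k)) n
    _ ≤ z (t n) := sub_le_self _ (hz0 _)
    _ ≤ x := hx _

/-! ### Moduli of disjoint weak-star null sequences. -/

theorem partialSups_nonneg_of_nonneg {y : ℕ → E} (hy : ∀ n, 0 ≤ y n) (k : ℕ) :
    0 ≤ partialSups y k := (hy 0).trans (le_partialSups_of_le y (Nat.zero_le k))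

theorem partialSups_le_sum_of_nonneg {y : ℕ → E} (hy : ∀ n, 0 ≤ y n) (k : ℕ) :
    partialSups y k ≤ ∑ i ∈ Finset.range (k + 1), y i :=
  partialSups_le _ _ _ fun _ hj => Finset.single_le_sum (fun i _ => hy i)
    (Finset.mem_range.2 (Nat.lt_succ_of_le hj))

theorem not_forall_le_dual_abs_apply (hE : IsSigmaDedekindComplete E) {f : ℕ → StrongDual ℝ E}
    (hfd : IsDisjointSeq f) (hf : ∀ y, Tendsto (fun n => f n y) atTop (𝓝 0)) {x : E} (hx : 0 ≤ x)
    {ε : ℝ} (hε : 0 < ε) : ¬ ∀ n, ε ≤ |f n| x := by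
  intro hcon
  have habs : ∀ n, 0 ≤ |f n| := fun n => dual_abs_nonneg _
  have hsel : ∀ n : ℕ, ∃ y ∈ Icc 0 x, |f n| (x - y) < ε / 4 ∧
      ∀ m < n, |f m| y ≤ (1 / 2) ^ n := fun n => by
    obtain ⟨y, hy, h1, h2⟩ := exists_mem_Icc_forall_lt (habs n) habs (Finset.range n)
      (fun i hi => hfd (Finset.mem_range.1 hi).ne') hx
      (η := min (ε / 4) ((1 / 2) ^ n)) (by positivity)
    exact ⟨y, hy, h1.trans_le (min_le_left _ _), fun m hm =>
      ((h2 m (Finset.mem_range.2 hm)).trans_le (min_le_right _ _)).le⟩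
  choose y hy hyn hym using hsel
  -- Finite stages of the tail suprema of `y`; `p` below plays the role of `x - limsup y`.
  set z : ℕ → ℕ → E := fun n k => partialSups (fun i => y (n + i)) k with hz
  have hz0 : ∀ n k, 0 ≤ z n k := fun n k => partialSups_nonneg_of_nonneg (fun i => (hy _).1) k
  have hzx : ∀ n k, z n k ≤ x := fun n k => partialSups_le _ _ _ fun j _ => (hy _).2
  have hzmono : ∀ n, Monotone (z n) := fun n => (partialSups _).monotone
  have hzsmall : ∀ n k, ∀ m < n, |f m| (z n k) ≤ 2 * (1 / 2) ^ n := fun n k m hm => by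
    have h1 := dual_apply_mono (habs m)
      (partialSups_le_sum_of_nonneg (y := fun i => y (n + i)) (fun i => (hy _).1) k)
    rw [map_sum] at h1
    refine h1.trans ?_
    calc ∑ i ∈ Finset.range (k + 1), |f m| (y (n + i))
        ≤ ∑ i ∈ Finset.range (k + 1), (1 / 2 : ℝ) ^ n * (1 / 2) ^ i :=
          Finset.sum_le_sum fun i _ => by
            rw [← pow_add]
            exact hym _ m (by omega)
      _ = (1 / 2) ^ n * ∑ i ∈ Finset.range (k + 1), (1 / 2 : ℝ) ^ i := by rw [Finset.mul_sum]
      _ ≤ (1 / 2) ^ n * 2 := by gcongr; exact sum_geometric_two_le _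
      _ = _ := mul_comm _ _
  have hK : ∀ n : ℕ, ∃ K, ∀ k ≥ K, ∀ m, |f m| (z n k - z n K) < ε / 8 * (1 / 2) ^ n := fun n =>
    exists_forall_dual_abs_sub_lt hE hf (hzmono n) (hz0 n) (hzx n) (by positivity)
  choose K hK using hK
  set p : ℕ → E := fun N => partialSups (fun n => x - z n (K n)) N with hp
  have hp0 : ∀ N, 0 ≤ p N := partialSups_nonneg_of_nonneg fun n => sub_nonneg.2 (hzx _ _)
  have hpx : ∀ N, p N ≤ x := fun N => partialSups_le _ _ _ fun n _ => sub_le_self _ (hz0 _ _)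
  have hpmono : Monotone p := (partialSups _).monotone
  obtain ⟨N, hN⟩ := exists_forall_dual_abs_sub_lt hE hf hpmono hp0 hpx (δ := ε / 4) (by positivity)
  -- Any `m` above all `n + K n` with `n ≤ N` would do: then `y m` enters each tail supremum only
  -- after stage `K n`, where the increment `r n` is uniformly small.
  set m : ℕ := ∑ n ∈ Finset.range (N + 1), (n + K n) with hm
  have hmn : ∀ n ≤ N, n + K n ≤ m := fun n hn =>
    Finset.single_le_sum (f := fun n => n + K n) (fun _ _ => Nat.zero_le _)
      (Finset.mem_range.2 (Nat.lt_succ_of_le hn))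
  set r : ℕ → E := fun n => z n (m - n) - z n (K n) with hr
  have hr0 : ∀ n ∈ Finset.range (N + 1), 0 ≤ r n := fun n hn =>
    sub_nonneg.2 (hzmono n (by have := hmn n (by simpa [Nat.lt_succ_iff] using hn); omega))
  have hpN : p N ≤ x - y m + ∑ n ∈ Finset.range (N + 1), r n := by
    refine partialSups_le _ _ _ fun n hn => ?_
    have hnN : n ∈ Finset.range (N + 1) := Finset.mem_range.2 (Nat.lt_succ_of_le hn)
    have h1 : r n ≤ ∑ n ∈ Finset.range (N + 1), r n := Finset.single_le_sum hr0 hnN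
    have h2 : y m ≤ z n (m - n) := by
      have := le_partialSups_of_le (fun i => y (n + i)) (le_refl (m - n))
      have hmn' := hmn n hn
      rwa [show n + (m - n) = m by omega] at this
    calc x - z n (K n) = x - z n (m - n) + r n := by simp only [hr]; abel
      _ ≤ _ := add_le_add (sub_le_sub_left h2 _) h1
  have hr1 : |f m| (∑ n ∈ Finset.range (N + 1), r n) ≤ ε / 4 := by
    rw [map_sum]
    calc ∑ n ∈ Finset.range (N + 1), |f m| (r n)
        ≤ ∑ n ∈ Finset.range (N + 1), ε / 8 * (1 / 2) ^ n :=
          Finset.sum_le_sum fun n hn => (hK n _ (by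
            have := hmn n (by simpa [Nat.lt_succ_iff] using hn); omega) m).le
      _ = ε / 8 * ∑ n ∈ Finset.range (N + 1), (1 / 2 : ℝ) ^ n := by rw [Finset.mul_sum]
      _ ≤ ε / 8 * 2 := by gcongr; exact sum_geometric_two_le _
      _ = ε / 4 := by ring
  obtain ⟨k₀, hk₀⟩ := exists_pow_lt_of_lt_one (show 0 < ε / 8 by positivity)
    (show (1 / 2 : ℝ) < 1 by norm_num)
  -- Now `|f m| x` splits along `x - p k`, `p k - p N` and `p N`, with contributions below `ε / 4`,
  -- `ε / 4` and `ε / 2`.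
  set k := k₀ + N + m + 1 with hk
  have h1 : |f m| (p k - p N) < ε / 4 := hN k (by omega) m
  have h2 : |f m| (x - p k) ≤ |f m| (z k (K k)) := by
    refine dual_apply_mono (habs m) (sub_le_comm.1 ?_)
    exact le_partialSups_of_le (fun n => x - z n (K n)) (le_refl k)
  have h3 := hzsmall k (K k) m (by omega)
  have h4 : (1 / 2 : ℝ) ^ k ≤ (1 / 2) ^ k₀ :=
    pow_le_pow_of_le_one (by norm_num) (by norm_num) (by omega)
  have h5 := dual_apply_mono (habs m) hpN
  have h6 := hcon m
  have h7 := hyn m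
  rw [map_add] at h5
  rw [map_sub] at h1 h2
  linarith

/-- In a `σ`-Dedekind complete Banach lattice, the moduli of a disjoint weak-star null sequence
form a weak-star null sequence. -/
theorem IsWeakStarNull.abs (hE : IsSigmaDedekindComplete E) {f : ℕ → StrongDual ℝ E}
    (hf : IsWeakStarNull f) (hfd : IsDisjointSeq f) : IsWeakStarNull fun n => |f n| := by
  rw [isWeakStarNull_iff] at hf ⊢
  have hpos : ∀ x, 0 ≤ x → Tendsto (fun n => |f n| x) atTop (𝓝 0) := fun x hx => by
    refine tendsto_order.2 ⟨fun a ha => Eventually.of_forall fun n =>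
      ha.trans_le (dual_apply_nonneg (dual_abs_nonneg _) hx), fun ε hε => ?_⟩
    by_contra hcon
    obtain ⟨φ, hφ, hφε⟩ := extraction_of_frequently_atTop (not_eventually.1 hcon)
    exact not_forall_le_dual_abs_apply hE (f := fun n => f (φ n))
      (fun i j hij => hfd (hφ.injective.ne hij)) (fun y => (hf y).comp hφ.tendsto_atTop) hx hε
      fun n => not_lt.1 (hφε n)
  intro x
  have := (hpos _ (posPart_nonneg x)).sub (hpos _ (negPart_nonneg x))
  rw [sub_zero] at this
  refine this.congr fun n => ?_
  rw [← map_sub, posPart_sub_negPart]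

/-! ### Disjointification. -/

variable [IsOrderedModule ℝ E]

/-- Disjointification of a bounded positive sequence up to a geometrically small error. -/
theorem isDisjointSeq_posPart_sub {b : ℕ → E} (hb : ∀ n, 0 ≤ b n) {s : E}
    (hs : ∀ n, (1 / 2 : ℝ) ^ n • b n ≤ s) :
    IsDisjointSeq fun k =>
      (b (k + 1) - (4 : ℝ) ^ k • ∑ i ∈ Finset.range (k + 1), b i - (1 / 2 : ℝ) ^ k • s)⁺ := by
  have hs0 : 0 ≤ s := (smul_nonneg (by positivity) (hb 0)).trans (hs 0)
  have hlt : ∀ j k, j < k →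
      (b (j + 1) - (4 : ℝ) ^ j • ∑ i ∈ Finset.range (j + 1), b i - (1 / 2 : ℝ) ^ j • s)⁺ ⊓
      (b (k + 1) - (4 : ℝ) ^ k • ∑ i ∈ Finset.range (k + 1), b i - (1 / 2 : ℝ) ^ k • s)⁺ = 0 := by
    intro j k hjk
    refine le_antisymm ?_ (le_inf (posPart_nonneg _) (posPart_nonneg _))
    -- The `k`-th term lies below `t⁺` and the `j`-th below `t⁻`, and these are disjoint.
    set t := b (k + 1) - (4 : ℝ) ^ k • b (j + 1) with ht
    have hk : b (k + 1) - (4 : ℝ) ^ k • ∑ i ∈ Finset.range (k + 1), b i - (1 / 2 : ℝ) ^ k • s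
        ≤ t := by
      refine (sub_le_self _ (smul_nonneg (by positivity) hs0)).trans (sub_le_sub_left ?_ _)
      exact smul_le_smul_of_nonneg_left (Finset.single_le_sum (fun i _ => hb i)
        (Finset.mem_range.2 (by omega))) (by positivity)
    have hj : b (j + 1) - (4 : ℝ) ^ j • ∑ i ∈ Finset.range (j + 1), b i - (1 / 2 : ℝ) ^ j • s
        ≤ t⁻ := by
      have h1 : b (j + 1) - (4 : ℝ) ^ j • ∑ i ∈ Finset.range (j + 1), b i - (1 / 2 : ℝ) ^ j • s
          ≤ b (j + 1) - (1 / 4 : ℝ) ^ k • b (k + 1) := by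
        refine sub_le_sub (sub_le_self _ (smul_nonneg (by positivity)
          (Finset.sum_nonneg fun i _ => hb i))) ?_
        -- As `j < k`, the exponent `j + (k + 1)` is at most `2 * k`, so the correction by `s`
        -- absorbs `(1 / 4) ^ k • b (k + 1)`.
        refine le_trans ?_ (smul_le_smul_of_nonneg_left (hs (k + 1)) (by positivity))
        rw [smul_smul, ← pow_add]
        refine smul_le_smul_of_nonneg_right ?_ (hb _)
        rw [show (1 / 4 : ℝ) = (1 / 2) ^ 2 by norm_num, ← pow_mul]
        exact pow_le_pow_of_le_one (by norm_num) (by norm_num) (by omega)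
      have h2 : b (j + 1) - (1 / 4 : ℝ) ^ k • b (k + 1) = (1 / 4 : ℝ) ^ k • (-t) := by
        rw [ht, neg_sub, smul_sub, smul_smul, ← mul_pow]
        norm_num
      rw [h2] at h1
      refine h1.trans ((smul_le_smul_of_nonneg_left (neg_le_negPart t) (by positivity)).trans ?_)
      exact smul_le_of_le_one_left (negPart_nonneg t) (pow_le_one₀ (by norm_num) (by norm_num))
    calc _ ≤ t⁻ ⊓ t⁺ := inf_le_inf (sup_le hj (negPart_nonneg t)) (posPart_mono hk)
      _ = 0 := by rw [inf_comm, posPart_inf_negPart_eq_zero]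
  intro j k hjk
  simp only [abs_of_nonneg (posPart_nonneg _)]
  rcases lt_or_gt_of_ne hjk with h | h
  · exact hlt j k h
  · rw [inf_comm]
    exact hlt k j h

/-- A weak-star null sequence of positive functionals that is not uniformly small on a bounded
positive sequence is not small on a disjoint sequence below it. -/
theorem exists_isDisjointSeq_le {g : ℕ → StrongDual ℝ E} (hg : ∀ n, 0 ≤ g n)
    (hg0 : ∀ y, Tendsto (fun n => g n y) atTop (𝓝 0)) {a : ℕ → E} (ha : ∀ n, 0 ≤ a n) {C : ℝ}
    (haC : ∀ n, ‖a n‖ ≤ C) {ε : ℝ} (hε : 0 < ε) (hga : ∀ n, ε ≤ g n (a n)) :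
    ∃ φ : ℕ → ℕ, StrictMono φ ∧ ∃ u : ℕ → E, IsDisjointSeq u ∧
      (∀ k, 0 ≤ u k ∧ u k ≤ a (φ k)) ∧ ∀ᶠ k in atTop, ε / 2 < g (φ k) (u k) := by
  -- Iterating `N` makes each chosen functional small on the weighted sum of all earlier terms. This
  -- correction and the one by `s` cost less than `ε / 4` each, leaving `ε / 2`.
  have hN : ∀ k : ℕ, ∃ N > k, ∀ n ≥ N,
      g n ((4 : ℝ) ^ k • ∑ i ∈ Finset.range (k + 1), a i) < ε / 4 := fun k => by
    obtain ⟨N, hN⟩ := eventually_atTop.1 ((hg0 ((4 : ℝ) ^ k • ∑ i ∈ Finset.range (k + 1), a i)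
      ).eventually_lt_const (show (0 : ℝ) < ε / 4 by positivity))
    exact ⟨max N (k + 1), by omega, fun n hn => hN n (by omega)⟩
  choose N hNk hN using hN
  set ψ : ℕ → ℕ := fun i => N^[i] 0 with hψ
  have hψ1 : ∀ i, ψ (i + 1) = N (ψ i) := fun i => Function.iterate_succ_apply' _ _ _
  have hψm : StrictMono ψ := strictMono_nat_of_lt_succ fun i => by rw [hψ1]; exact hNk _
  have hsum : Summable fun n => (1 / 2 : ℝ) ^ n • a (ψ n) := by
    refine Summable.of_norm_bounded (g := fun n => (1 / 2 : ℝ) ^ n * C)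
      (summable_geometric_two.mul_right C) fun n => ?_
    rw [norm_smul, Real.norm_of_nonneg (by positivity)]
    gcongr
    exact haC _
  set s := ∑' n, (1 / 2 : ℝ) ^ n • a (ψ n) with hs
  have hsle : ∀ n, (1 / 2 : ℝ) ^ n • a (ψ n) ≤ s := fun n =>
    hsum.le_tsum n fun j _ => smul_nonneg (by positivity) (ha _)
  have hs0 : 0 ≤ s := (smul_nonneg (by positivity) (ha _)).trans (hsle 0)
  refine ⟨fun k => ψ (k + 1), fun i j hij => hψm (Nat.succ_lt_succ hij), _,
    isDisjointSeq_posPart_sub (b := fun n => a (ψ n)) (fun n => ha _) hsle,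
    fun k => ⟨posPart_nonneg _, sup_le ?_ (ha _)⟩, ?_⟩
  · rw [sub_sub]
    exact sub_le_self _ (add_nonneg (smul_nonneg (by positivity)
      (Finset.sum_nonneg fun i _ => ha _)) (smul_nonneg (by positivity) hs0))
  · have hshift : Tendsto (fun k => ψ (k + 1)) atTop atTop :=
      hψm.tendsto_atTop.comp (tendsto_add_atTop_nat 1)
    filter_upwards [((hg0 s).comp hshift).eventually_lt_const
      (show (0 : ℝ) < ε / 4 by positivity)] with k hk
    have h1 := dual_apply_mono (hg (ψ (k + 1))) (le_posPart (a (ψ (k + 1)) -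
      (4 : ℝ) ^ k • ∑ i ∈ Finset.range (k + 1), a (ψ i) - (1 / 2 : ℝ) ^ k • s))
    rw [map_sub, map_sub] at h1
    have h2 : g (ψ (k + 1)) ((1 / 2 : ℝ) ^ k • s) ≤ g (ψ (k + 1)) s :=
      dual_apply_mono (hg _) (smul_le_of_le_one_left hs0 (pow_le_one₀ (by norm_num) (by norm_num)))
    have h3 : g (ψ (k + 1)) ((4 : ℝ) ^ k • ∑ i ∈ Finset.range (k + 1), a (ψ i)) ≤
        g (ψ (k + 1)) ((4 : ℝ) ^ ψ k • ∑ i ∈ Finset.range (ψ k + 1), a i) := by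
      refine dual_apply_mono (hg _) ?_
      have h4 : ∑ i ∈ Finset.range (k + 1), a (ψ i) ≤ ∑ i ∈ Finset.range (ψ k + 1), a i := by
        rw [← Finset.sum_image (s := Finset.range (k + 1)) (g := ψ) (f := a) hψm.injective.injOn]
        refine Finset.sum_le_sum_of_subset_of_nonneg (fun i hi => ?_) fun i _ _ => ha i
        obtain ⟨j, hj, rfl⟩ := Finset.mem_image.1 hi
        exact Finset.mem_range.2 (Nat.lt_succ_of_le
          (hψm.monotone (Nat.lt_succ_iff.1 (Finset.mem_range.1 hj))))
      refine (smul_le_smul_of_nonneg_left h4 (by positivity)).trans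
        (smul_le_smul_of_nonneg_right ?_ (Finset.sum_nonneg fun i _ => ha i))
      exact pow_le_pow_right₀ (by norm_num) (hψm.id_le k)
    have h5 := hN (ψ k) (ψ (k + 1)) (hψ1 k).ge
    have h6 := hga (ψ (k + 1))
    simp only [Function.comp] at hk
    linarith

end Dual
end BanachLattice

end

/-! ### The equivalence. -/

open BanachLattice in
theorem theorem1 {E : Type*} [NormedAddCommGroup E] [NormedSpace ℝ E] [CompleteSpace E]
    [Lattice E] [IsOrderedAddMonoid E] [IsOrderedModule ℝ E] [HasSolidNorm E]
    (hE : IsSigmaDedekindComplete E) (S : Set E) (hS : Bornology.IsBounded S)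
    (hsolid : LatticeOrderedAddCommGroup.IsSolid S) :
    List.TFAE [
      IsAlmostLimited S,
      ∀ (x : ℕ → E) (f : ℕ → StrongDual ℝ E), (∀ n, x n ∈ S) → IsDisjointSeq x →
        IsDisjointSeq f → IsWeakStarNull f →
        Filter.Tendsto (fun n => f n (x n)) Filter.atTop (nhds 0),
      ∀ (x : ℕ → E) (f : ℕ → StrongDual ℝ E), (∀ n, x n ∈ S ∧ 0 ≤ x n) → IsDisjointSeq x →
        (∀ n, 0 ≤ f n) → IsDisjointSeq f → IsWeakStarNull f →
        Filter.Tendsto (fun n => f n (x n)) Filter.atTop (nhds 0)] := by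
  tfae_have 1 → 2 := fun h x f hx _ hfd hf => by
    refine Metric.tendsto_nhds.2 fun ε hε => ?_
    filter_upwards [Metric.tendstoUniformlyOn_iff.1 (h.2 f hfd hf) ε hε] with n hn
    rw [dist_comm]
    exact hn _ (hx n)
  tfae_have 2 → 3 := fun h x f hx hxd _ hfd hf => h x f (fun n => (hx n).1) hxd hfd hf
  tfae_have 3 → 1 := fun h => by
    refine ⟨hS, fun f hfd hf => ?_⟩
    have hg0 := isWeakStarNull_iff.1 (hf.abs hE hfd)
    rw [Metric.tendstoUniformlyOn_iff]
    by_contra! hcon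
    obtain ⟨ε, hε, hcon⟩ := hcon
    obtain ⟨φ, hφ, hφε⟩ := Filter.extraction_of_frequently_atTop hcon
    choose x hxS hxε using hφε
    obtain ⟨C, hC⟩ := hS.exists_norm_le
    obtain ⟨ψ, hψ, u, hud, hu, huε⟩ := exists_isDisjointSeq_le (g := fun n => |f (φ n)|)
      (fun n => dual_abs_nonneg _) (fun y => (hg0 y).comp hφ.tendsto_atTop)
      (a := fun n => |x n|) (fun n => abs_nonneg _) (C := C)
      (fun n => (norm_abs_eq_norm (x n)).trans_le (hC _ (hxS n))) hε fun n => by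
        have := hxε n
        rw [dist_comm, Real.dist_eq, sub_zero] at this
        exact this.trans (abs_dual_apply_le_abs _ _)
    -- The functionals are indexed by `φ (ψ k)`, to match `u k ≤ |x (ψ k)|`.
    have hlim := h u (fun k => |f (φ (ψ k))|)
      (fun k => ⟨hsolid (hxS (ψ k)) ((abs_of_nonneg (hu k).1).trans_le (hu k).2), (hu k).1⟩) hud
      (fun k => dual_abs_nonneg _) (fun i j hij => by
        simp only [dual_abs_of_nonneg (dual_abs_nonneg _)]
        exact hfd (hφ.injective.ne (hψ.injective.ne hij)))
      (isWeakStarNull_iff.2 fun y => (hg0 y).comp (hφ.comp hψ).tendsto_atTop)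
    obtain ⟨k, hk1, hk2⟩ := (huε.and (hlim.eventually_lt_const (half_pos hε))).exists
    exact lt_asymm hk1 hk2
  tfae_finish
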